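/- **Setting.** There are finite disjoint sets $\mathcal I$ of customers and $\mathcal J$ of providers; $\mathcal A=\mathcal I\cup\mathcal J$ is the set of all agents. Each agent $a$ has a known type $c_a$ in a finite set $\mathcal C$. Preferences are typed: for an unknown $f:\mathcal C\times\mathcal C\to[-1,1]$, the utility of $a$ when matched to an agent $a'$ on the other side is $u(a,a')=f(c_a,c_{a'})$, and $u(a,a')=0$ if $a,a'$ are on the same side or $a=a'$ (unmatched). In round $t=1,\dots,T$ a set $A^t\subseteq\mathcal A$ of agents arrives (the sequence is arbitrary and fixed in advance); $n=\max_t|A^t|$. The platform chooses a matching $X^t$ between the customers and the providers in $A^t$, with partner map $\mu_{X^t}$ ($\mu_{X^t}(a)=a$ if $a$ is unmatched), and transfers $\tau^t\in\mathbb R^{A^t}$, and then observes $u(a,\mu_{X^t}(a))+\varepsilon_{a,t}$ for each $a\in A^t$, where the $\varepsilon_{a,t}$ are independent and $1$-subgaussian, i.e. $\mathbb E e^{\lambda\varepsilon_{a,t}}\le e^{\lambda^2/2}$ for all $\lambda\in\mathbb R$. With $\mathscr X_S$ the set of matchings on $S$, the *Subset Instability* of $(X,\tau)$ in the market $A$ is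 $$I(u;X,\tau)=\max_{S\subseteq A}\Bigl[\max_{X'\in\mathscr X_S}\sum_{a\in S}u(a,\mu_{X'}(a))-\sum_{a\in S}\bigl(u(a,\mu_X(a))+\tau_a\bigr)\Bigr],$$ and the regret is $R_T=\sum_{t=1}^T I(u;X^t,\tau^t)$, with the $t$-th term taken in the market $A^t$. **MatchTypedUCB.** Before a round, let $n_{cc'}$ be the number of pairs matched so far whose two types are $c$ and $c'$, and let $\hat f(c,c')$ be the mean of all utilities observed so far by agents of type $c$ that were matched to an agent of type $c'$. Put $C_{c,c'}=[-1,1]$ if $n_{cc'}=0$ and otherwise $$C_{c,c'}=\Bigl[\hat f(c,c')-8\sqrt{\log(|\mathcal A|T)/n_{cc'}},\ \hat f(c,c')+8\sqrt{\log(|\mathcal A|T)/n_{cc'}}\Bigr]\cap[-1,1].$$ Let $w(a,a')=\max C_{c_a,c_{a'}}$ for agents on opposite sides (any value in $[-1,1]$, depending only on the types, if that set is empty) and $w(a,a')=0$ otherwise. Choose an optimal primal-dual pair $(X^t,p)$, with $X^t$ a matching, of the linear programs: maximize $\sum_{i,j}Z_{ij}(w(i,j)+w(j,i))$ over $Z\ge0$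 with $\sum_jZ_{ij}\le1$ and $\sum_iZ_{ij}\le1$; minimize $\sum_ap_a$ over $p\ge0$ with $p_i+p_j\ge w(i,j)+w(j,i)$ (here $i$, $j$, $a$ range over the customers, providers and agents in $A^t$). Set $\tau^t_a=p_a-w(a,\mu_{X^t}(a))$. The choice among several optimal pairs is arbitrary, but measurable with respect to the noise of the past rounds. **Theorem.** There is an absolute constant $K>0$ such that, in every such market and for every $T$, the regret of MatchTypedUCB is integrable and $$\mathbb E(R_T)\le K\Bigl(|\mathcal C|\sqrt{nT\log(|\mathcal A|T)}+|\mathcal C|^2n\Bigr);$$ moreover, whenever $T\ge|\mathcal C|^2n$, $$\mathbb E(R_T)\le K\,|\mathcal C|\sqrt{nT\log(|\mathcal A|T)}.$$ -/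

import Mathlib

open MeasureTheory ProbabilityTheory

universe u₁ u₂ u₃ u₄

noncomputable section

namespace TypedMatching

variable {I : Type u₁} {J : Type u₂} {C : Type u₃}

/-- A global utility function. Customers are `I`, providers are `J`, and the set of all agents is
the disjoint union `I ⊕ J`; `u a a'` is the utility of `a` when matched to `a'`. -/
abbrev Utility (I : Type u₁) (J : Type u₂) := I ⊕ J → I ⊕ J → ℝ

/-- The utility function given by a function `f` of the two agents' types. Utilities between agents
on the same side of the market, and of an agent with itself (being unmatched), are `0`. -/
def typedUtility (c : I ⊕ J → C) (f : C → C → ℝ) : Utility I J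
  | Sum.inl i, Sum.inr j => f (c (Sum.inl i)) (c (Sum.inr j))
  | Sum.inr j, Sum.inl i => f (c (Sum.inr j)) (c (Sum.inl i))
  | _, _ => 0

/-- The class of typed preferences: `u (a, a') = f (c a, c a')` for some `f : C × C → [-1, 1]`. -/
def typedPreferences (c : I ⊕ J → C) : Set (Utility I J) :=
  {u | ∃ f : C → C → ℝ, (∀ x y, f x y ∈ Set.Icc (-1 : ℝ) 1) ∧ u = typedUtility c f}

/-- `X` is a matching on the set `S` of agents: a set of pairwise disjoint customer-provider pairs
whose members belong to `S`. -/
def IsMatchingOn (S : Finset (I ⊕ J)) (X : Finset (I × J)) : Prop :=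
  (∀ p ∈ X, Sum.inl p.1 ∈ S ∧ Sum.inr p.2 ∈ S) ∧
    ∀ p ∈ X, ∀ q ∈ X, p ≠ q → p.1 ≠ q.1 ∧ p.2 ≠ q.2

theorem isMatchingOn_empty (S : Finset (I ⊕ J)) : IsMatchingOn S ∅ := by
  simp [IsMatchingOn]

open Classical in
/-- The functional representation `μ_X` of a matching: the partner of `a`, or `a` itself if `a` is
unmatched. -/
def partner (X : Finset (I × J)) : I ⊕ J → I ⊕ J
  | Sum.inl i => if h : ∃ j, (i, j) ∈ X then Sum.inr h.choose else Sum.inl i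
  | Sum.inr j => if h : ∃ i, (i, j) ∈ X then Sum.inl h.choose else Sum.inr j

section Instability

variable [Fintype I] [Fintype J]

open Classical in
/-- The finite set of all matchings on `S`. -/
def matchingsOn (S : Finset (I ⊕ J)) : Finset (Finset (I × J)) :=
  Finset.univ.filter (IsMatchingOn S)

theorem matchingsOn_nonempty (S : Finset (I ⊕ J)) : (matchingsOn S).Nonempty :=
  ⟨∅, by simp [matchingsOn, isMatchingOn_empty]⟩

/-- The maximum total utility of a matching on `S`. -/
def maxMatchingUtility (u : Utility I J) (S : Finset (I ⊕ J)) : ℝ :=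
  (matchingsOn S).sup' (matchingsOn_nonempty S) fun X => ∑ a ∈ S, u a (partner X a)

/-- Subset Instability of the market outcome `(X, τ)` in the market with set of agents `A`. -/
def subsetInstability (A : Finset (I ⊕ J)) (u : Utility I J) (X : Finset (I × J))
    (τ : I ⊕ J → ℝ) : ℝ :=
  A.powerset.sup' ⟨∅, Finset.empty_mem_powerset A⟩ fun S =>
    maxMatchingUtility u S - ∑ a ∈ S, (u a (partner X a) + τ a)

end Instability

section LinearPrograms

/-- Feasibility for the primal (fractional matching) linear program of the market `A`. -/
def IsPrimalFeasible (A : Finset (I ⊕ J)) (Z : I → J → ℝ) : Prop :=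
  (∀ i ∈ A.toLeft, ∑ j ∈ A.toRight, Z i j ≤ 1) ∧
  (∀ j ∈ A.toRight, ∑ i ∈ A.toLeft, Z i j ≤ 1) ∧
  ∀ i ∈ A.toLeft, ∀ j ∈ A.toRight, 0 ≤ Z i j

/-- The primal objective. -/
def primalObjective (A : Finset (I ⊕ J)) (u : Utility I J) (Z : I → J → ℝ) : ℝ :=
  ∑ i ∈ A.toLeft, ∑ j ∈ A.toRight,
    Z i j * (u (Sum.inl i) (Sum.inr j) + u (Sum.inr j) (Sum.inl i))

/-- `Z` is an optimal primal solution. -/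
def IsPrimalOptimal (A : Finset (I ⊕ J)) (u : Utility I J) (Z : I → J → ℝ) : Prop :=
  IsPrimalFeasible A Z ∧
    ∀ Z', IsPrimalFeasible A Z' → primalObjective A u Z' ≤ primalObjective A u Z

/-- Feasibility for the dual linear program of the market `A` (`p` are the prices). -/
def IsDualFeasible (A : Finset (I ⊕ J)) (u : Utility I J) (p : I ⊕ J → ℝ) : Prop :=
  (∀ i ∈ A.toLeft, ∀ j ∈ A.toRight,
    u (Sum.inl i) (Sum.inr j) + u (Sum.inr j) (Sum.inl i) ≤ p (Sum.inl i) + p (Sum.inr j)) ∧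
  ∀ a ∈ A, 0 ≤ p a

/-- `p` is an optimal dual solution. -/
def IsDualOptimal (A : Finset (I ⊕ J)) (u : Utility I J) (p : I ⊕ J → ℝ) : Prop :=
  IsDualFeasible A u p ∧ ∀ p', IsDualFeasible A u p' → ∑ a ∈ A, p a ≤ ∑ a ∈ A, p' a

open Classical in
/-- `(X, τ)` is a possible output of the procedure ComputeMatch in the market `A` when the upper
confidence bounds of the utilities are `w`: for some optimal primal-dual pair whose primal part is
the indicator of the matching `X` and whose dual part is `p`, the transfers are
`τ a = p a - w a (μ_X a)`. -/
def IsComputeMatchOutput (A : Finset (I ⊕ J)) (w : Utility I J) (X : Finset (I × J))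
    (τ : I ⊕ J → ℝ) : Prop :=
  IsMatchingOn A X ∧ IsPrimalOptimal A w (fun i j => if (i, j) ∈ X then 1 else 0) ∧
    ∃ p, IsDualOptimal A w p ∧ ∀ a ∈ A, τ a = p a - w a (partner X a)

end LinearPrograms

section Algorithm

/-- The noisy utility observed for agent `a` in a round in which the matching is `X` and the noise
of `a` is `e a`. -/
def feedback (u : Utility I J) (X : Finset (I × J)) (e : I ⊕ J → ℝ) (a : I ⊕ J) : ℝ :=
  u a (partner X a) + e a

variable {T : ℕ}

open Classical in
/-- The number of times that, before round `t`, an agent of type `x` was matched with an agent of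
type `y` (the counter `n_{x y} = n_{y x}`, increased once for each matched pair). -/
def matchCount (c : I ⊕ J → C) (X : Fin T → Finset (I × J)) (t : Fin T) (x y : C) : ℕ :=
  ∑ s ∈ Finset.Iio t, ((X s).filter fun q =>
    (c (Sum.inl q.1) = x ∧ c (Sum.inr q.2) = y) ∨
      (c (Sum.inl q.1) = y ∧ c (Sum.inr q.2) = x)).card

open Classical in
/-- The agents among `A` who have type `x` and are matched in `X` to an agent of type `y`; the
feedback of each of them is an observation of `f (x, y)`. -/
def observers (c : I ⊕ J → C) (A : Finset (I ⊕ J)) (X : Finset (I × J)) (x y : C) :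
    Finset (I ⊕ J) :=
  A.filter fun a => partner X a ≠ a ∧ c a = x ∧ c (partner X a) = y

/-- The empirical mean of all observations of `f (x, y)` made before round `t`. -/
def empiricalMean (c : I ⊕ J → C) (u : Utility I J) (A : Fin T → Finset (I ⊕ J))
    (X : Fin T → Finset (I × J)) (e : I ⊕ J → Fin T → ℝ) (t : Fin T) (x y : C) : ℝ :=
  (∑ s ∈ Finset.Iio t, ∑ a ∈ observers c (A s) (X s) x y, feedback u (X s) (fun b => e b s) a) /
    ((∑ s ∈ Finset.Iio t, (observers c (A s) (X s) x y).card : ℕ) : ℝ)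

/-- The confidence set of a pair of types: `[-1, 1]` if the counter `k` is `0`, and otherwise the
interval of radius `8 √(log (N T) / k)` around the empirical mean `m`, intersected with `[-1, 1]`.
Here `N` is the total number of agents and `T` the number of rounds. -/
def confidenceSet (N T k : ℕ) (m : ℝ) : Set ℝ :=
  if k = 0 then Set.Icc (-1) 1
  else Set.Icc (m - 8 * √(Real.log (N * T) / k)) (m + 8 * √(Real.log (N * T) / k)) ∩ Set.Icc (-1) 1

/-- `v` is the maximum of the confidence set `K ⊆ [-1, 1]`. If `K` is empty, so that no maximum
exists, any `v` in `[-1, 1]` is allowed. -/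
def IsUpperConfidence (K : Set ℝ) (v : ℝ) : Prop :=
  v ∈ Set.Icc (-1 : ℝ) 1 ∧ (K.Nonempty → IsGreatest K v)

/-- The information about the noise available before round `t`. -/
@[reducible] def past {Ω : Type u₄} (ε : I ⊕ J → Fin T → Ω → ℝ) (t : Fin T) : MeasurableSpace Ω :=
  ⨆ s : Fin T, ⨆ _ : s < t, ⨆ a, (borel ℝ).comap (ε a s)

variable [Fintype I] [Fintype J]

/-- The outcomes `(X t, τ t)`, `t < T`, are those of a run of MatchTypedUCB on `T` rounds, in the
market with types `c`, true utilities `u`, sets `A t` of arriving agents and noise `ε`. The choice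
among several optimal primal-dual pairs may be made in any way that uses past information only. -/
structure IsMatchTypedUCBRun {Ω : Type u₄} (c : I ⊕ J → C) (u : Utility I J)
    (A : Fin T → Finset (I ⊕ J)) (ε : I ⊕ J → Fin T → Ω → ℝ)
    (X : Fin T → Ω → Finset (I × J)) (τ : Fin T → Ω → I ⊕ J → ℝ) : Prop where
  output : ∀ t ω, ∃ v : C → C → ℝ,
    (∀ x y, IsUpperConfidence
      (confidenceSet (Fintype.card (I ⊕ J)) T (matchCount c (fun s => X s ω) t x y)
        (empiricalMean c u A (fun s => X s ω) (fun a s => ε a s ω) t x y)) (v x y)) ∧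
    IsComputeMatchOutput (A t) (typedUtility c v) (X t ω) (τ t ω)
  matching_nonanticipating : ∀ t Y, MeasurableSet[past ε t] {ω | X t ω = Y}
  transfers_nonanticipating : ∀ t, ∀ a ∈ A t, Measurable[past ε t] fun ω => τ t ω a

/-- The regret: cumulative Subset Instability with respect to the true utilities. -/
def regret {Ω : Type u₄} (u : Utility I J) (A : Fin T → Finset (I ⊕ J))
    (X : Fin T → Ω → Finset (I × J)) (τ : Fin T → Ω → I ⊕ J → ℝ) (ω : Ω) : ℝ :=
  ∑ t, subsetInstability (A t) u (X t ω) (τ t ω)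

end Algorithm

end TypedMatching

end

/-! Optimism reduces instability to confidence widths. If `w ≥ u`, a matching inside any `S ⊆ A` is
worth at most the sum of the prices `p` over `S`, by weak duality. Agent `a` receives `u + τ = p -
(w - u)`, so the instability is at most the sum of `w - u` over all agents
(`IsComputeMatchOutput.subsetInstability_le`). Only dual feasibility of `p` is needed.

Grouped by ordered type pairs, each pair contributes a sum of (new observations) times (width),
where the width is at most `2` and, after `M` observations, at most `16 √(2L/M)` with `L = log (N
T)`, `N` being the number of agents. Observations come in batches of size at most `n`, within which
the width does not shrink; a potential argument (`potential_step`, `sum_batch_le`) gives `4n + 64 √L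
√M_total` per pair. There are at most `nT` observations in all, so Cauchy–Schwarz over the `|C|²`
pairs produces `|C| √(nTL)`.

The bounds hold with high probability: who observes in a round is decided by the past, while the
noise of that round is independent of it, so the exponential of the accumulated noise, normalised by
the number of observations, has expectation at most `1` (`lintegral_expNoise_le`). A Chernoff bound
and a union over rounds, pairs of agents and observation counts follow. On the exceptional event the
regret is at most `3nT`, which costs `6n` in expectation. -/

noncomputable section

namespace TypedMatching

/-! ### Matchings, weak duality and instability -/

section Matchings

variable {I : Type u₁} {J : Type u₂} {C : Type u₃} {A S : Finset (I ⊕ J)} {X : Finset (I × J)}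

theorem IsMatchingOn.partner_inl (hX : IsMatchingOn A X) {i : I} {j : J} (h : (i, j) ∈ X) :
    partner X (Sum.inl i) = Sum.inr j := by
  have hex : ∃ j, (i, j) ∈ X := ⟨j, h⟩
  simp only [partner, dif_pos hex, Sum.inr.injEq]
  by_contra hne
  exact (hX.2 _ hex.choose_spec _ h (by simpa using hne)).1 rfl

theorem IsMatchingOn.partner_inr (hX : IsMatchingOn A X) {i : I} {j : J} (h : (i, j) ∈ X) :
    partner X (Sum.inr j) = Sum.inl i := by
  have hex : ∃ i, (i, j) ∈ X := ⟨i, h⟩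
  simp only [partner, dif_pos hex, Sum.inl.injEq]
  by_contra hne
  exact (hX.2 _ hex.choose_spec _ h (by simpa using hne)).2 rfl

/-- An agent is unmatched, or belongs to a pair of the matching. -/
theorem IsMatchingOn.partner_cases (hX : IsMatchingOn A X) (a : I ⊕ J) :
    partner X a = a ∨ ∃ q ∈ X, (a = Sum.inl q.1 ∧ partner X a = Sum.inr q.2) ∨
      (a = Sum.inr q.2 ∧ partner X a = Sum.inl q.1) := by
  rcases a with i | j
  · by_cases h : ∃ j, (i, j) ∈ X
    · obtain ⟨j, hj⟩ := h
      exact Or.inr ⟨(i, j), hj, Or.inl ⟨rfl, hX.partner_inl hj⟩⟩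
    · exact Or.inl (by simp [partner, h])
  · by_cases h : ∃ i, (i, j) ∈ X
    · obtain ⟨i, hi⟩ := h
      exact Or.inr ⟨(i, j), hi, Or.inr ⟨rfl, hX.partner_inr hi⟩⟩
    · exact Or.inl (by simp [partner, h])

theorem IsMatchingOn.partner_partner (hX : IsMatchingOn A X) (a : I ⊕ J) :
    partner X (partner X a) = a := by
  rcases hX.partner_cases a with h | ⟨⟨i, j⟩, hq, ⟨rfl, h⟩ | ⟨rfl, h⟩⟩
  · rw [h, h]
  · rw [h, hX.partner_inr hq]
  · rw [h, hX.partner_inl hq]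

theorem IsMatchingOn.partner_mem (hX : IsMatchingOn A X) {a : I ⊕ J} (ha : a ∈ A) :
    partner X a ∈ A := by
  rcases hX.partner_cases a with h | ⟨⟨i, j⟩, hq, ⟨rfl, h⟩ | ⟨rfl, h⟩⟩
  · rwa [h]
  · rw [h]; exact (hX.1 _ hq).2
  · rw [h]; exact (hX.1 _ hq).1

theorem IsMatchingOn.sum_comp_partner (hX : IsMatchingOn A X) (g : I ⊕ J → ℝ) :
    ∑ a ∈ A, g (partner X a) = ∑ a ∈ A, g a :=
  Finset.sum_nbij' (partner X) (partner X) (fun _ ha => hX.partner_mem ha)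
    (fun _ ha => hX.partner_mem ha) (fun a _ => hX.partner_partner a)
    (fun a _ => hX.partner_partner a) fun _ _ => rfl

/-- Types of matched agents give the utility; unmatched agents have utility zero. -/
theorem IsMatchingOn.typedUtility_partner (hX : IsMatchingOn A X) (c : I ⊕ J → C) (f : C → C → ℝ)
    (a : I ⊕ J) : (partner X a = a ∧ typedUtility c f a (partner X a) = 0) ∨
      (partner X a ≠ a ∧ typedUtility c f a (partner X a) = f (c a) (c (partner X a))) := by
  rcases hX.partner_cases a with h | ⟨⟨i, j⟩, hq, ⟨rfl, h⟩ | ⟨rfl, h⟩⟩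
  · refine Or.inl ⟨h, ?_⟩
    rw [h]
    rcases a with i | j <;> rfl
  · exact Or.inr ⟨by simp [h], by simp [h, typedUtility]⟩
  · exact Or.inr ⟨by simp [h], by simp [h, typedUtility]⟩

theorem typedUtility_self (c : I ⊕ J → C) (f : C → C → ℝ) (a : I ⊕ J) :
    typedUtility c f a a = 0 := by
  rcases a with i | j <;> rfl

theorem typedUtility_mem_Icc (c : I ⊕ J → C) {f : C → C → ℝ}
    (hf : ∀ x y, f x y ∈ Set.Icc (-1 : ℝ) 1) (a b : I ⊕ J) :
    typedUtility c f a b ∈ Set.Icc (-1 : ℝ) 1 := by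
  rcases a with i | j <;> rcases b with i' | j' <;> simp only [typedUtility] <;>
    first | exact hf _ _ | norm_num

theorem typedUtility_mono (c : I ⊕ J → C) {f v : C → C → ℝ}
    (h : ∀ a b, f (c a) (c b) ≤ v (c a) (c b)) (a b : I ⊕ J) :
    typedUtility c f a b ≤ typedUtility c v a b := by
  rcases a with i | j <;> rcases b with i' | j' <;> simp only [typedUtility] <;>
    first | exact h _ _ | exact le_rfl

/-- Weak duality: a matching among agents of `S` is worth at most their total price. -/
theorem IsDualFeasible.sum_utility_le {w : Utility I J} (hw : ∀ a, w a a = 0) {p : I ⊕ J → ℝ}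
    (hp : IsDualFeasible A w p) (hS : S ⊆ A) (hX : IsMatchingOn S X) :
    ∑ a ∈ S, w a (partner X a) ≤ ∑ a ∈ S, p a := by
  -- Every agent is added to its partner. The partner map is an involution of `S`, so both sides are
  -- twice the desired sums.
  have h1 : ∑ a ∈ S, (w a (partner X a) + w (partner X a) (partner X (partner X a))) ≤
      ∑ a ∈ S, (p a + p (partner X a)) := by
    refine Finset.sum_le_sum fun a ha => ?_
    rw [hX.partner_partner]
    rcases hX.partner_cases a with h | ⟨⟨i, j⟩, hq, ⟨rfl, h⟩ | ⟨rfl, h⟩⟩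
    · rw [h, hw]
      have := hp.2 a (hS ha)
      linarith
    · rw [h]
      exact hp.1 i (by simpa using hS (hX.1 _ hq).1) j (by simpa using hS (hX.1 _ hq).2)
    · rw [h]
      have := hp.1 i (by simpa using hS (hX.1 _ hq).1) j (by simpa using hS (hX.1 _ hq).2)
      dsimp only
      linarith
  rw [Finset.sum_add_distrib, Finset.sum_add_distrib, hX.sum_comp_partner p,
    hX.sum_comp_partner fun a => w a (partner X a)] at h1
  linarith

variable [Fintype I] [Fintype J]

theorem mem_matchingsOn : X ∈ matchingsOn S ↔ IsMatchingOn S X := by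
  simp [matchingsOn]

theorem subsetInstability_nonneg (u : Utility I J) (τ : I ⊕ J → ℝ) :
    0 ≤ subsetInstability A u X τ := by
  have h1 : (0 : ℝ) ≤ maxMatchingUtility u (∅ : Finset (I ⊕ J)) := by
    refine Finset.le_sup'_of_le _ (b := ∅) (mem_matchingsOn.2 (isMatchingOn_empty _)) (by simp)
  exact Finset.le_sup'_of_le _ (b := ∅) (Finset.empty_mem_powerset A) (by simpa using h1)

/-- If the confidence bounds dominate the utilities, the instability of the computed outcome is at
most the total width over the chosen matching. -/
theorem IsComputeMatchOutput.subsetInstability_le {u w : Utility I J} {τ : I ⊕ J → ℝ}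
    (h : IsComputeMatchOutput A w X τ) (hw : ∀ a, w a a = 0) (huw : ∀ a b, u a b ≤ w a b) :
    subsetInstability A u X τ ≤ ∑ a ∈ A, (w a (partner X a) - u a (partner X a)) := by
  obtain ⟨-, -, p, ⟨hp, -⟩, hτ⟩ := h
  refine Finset.sup'_le _ _ fun S hS => ?_
  rw [Finset.mem_powerset] at hS
  have h1 : maxMatchingUtility u S ≤ ∑ a ∈ S, p a := by
    refine Finset.sup'_le _ _ fun Y hY => ?_
    exact (Finset.sum_le_sum fun a _ => huw _ _).trans
      (hp.sum_utility_le hw hS (mem_matchingsOn.1 hY))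
  have h2 : ∑ a ∈ S, (u a (partner X a) + τ a) =
      ∑ a ∈ S, p a - ∑ a ∈ S, (w a (partner X a) - u a (partner X a)) := by
    rw [← Finset.sum_sub_distrib]
    refine Finset.sum_congr rfl fun a ha => ?_
    rw [hτ a (hS ha)]
    ring
  have h3 : ∑ a ∈ S, (w a (partner X a) - u a (partner X a)) ≤
      ∑ a ∈ A, (w a (partner X a) - u a (partner X a)) :=
    Finset.sum_le_sum_of_subset_of_nonneg hS fun a _ _ => sub_nonneg.2 (huw _ _)
  linarith

/-- The crude bound for when optimism fails: a matching on `S` is worth at most `|S|`, and `u + τ =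
p + u - w ≥ -2` for each agent. -/
theorem IsComputeMatchOutput.subsetInstability_le_card {u w : Utility I J} {τ : I ⊕ J → ℝ}
    (h : IsComputeMatchOutput A w X τ) (hu : ∀ a b, u a b ∈ Set.Icc (-1 : ℝ) 1)
    (hw : ∀ a b, w a b ∈ Set.Icc (-1 : ℝ) 1) :
    subsetInstability A u X τ ≤ 3 * A.card := by
  obtain ⟨-, -, p, ⟨hp, -⟩, hτ⟩ := h
  refine Finset.sup'_le _ _ fun S hS => ?_
  rw [Finset.mem_powerset] at hS
  have h1 : maxMatchingUtility u S ≤ S.card := by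
    refine Finset.sup'_le _ _ fun Y _ => ?_
    simpa using Finset.sum_le_sum fun a (_ : a ∈ S) => (hu a (partner Y a)).2
  have h2 : ∑ a ∈ S, (-2 : ℝ) ≤ ∑ a ∈ S, (u a (partner X a) + τ a) := by
    refine Finset.sum_le_sum fun a ha => ?_
    rw [hτ a (hS ha)]
    have := hp.2 a (hS ha)
    have := (hu a (partner X a)).1
    have := (hw a (partner X a)).2
    linarith
  have h3 : (S.card : ℝ) ≤ A.card := by exact_mod_cast Finset.card_le_card hS
  simp only [Finset.sum_const, nsmul_eq_mul] at h2
  linarith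

end Matchings

/-! ### Observations of a pair of types -/

section Observers

variable {I : Type u₁} {J : Type u₂} {C : Type u₃} {A : Finset (I ⊕ J)} {X : Finset (I × J)}

theorem mem_observers {c : I ⊕ J → C} {x y : C} {a : I ⊕ J} :
    a ∈ observers c A X x y ↔ a ∈ A ∧ partner X a ≠ a ∧ c a = x ∧ c (partner X a) = y := by
  simp [observers]

-- The counter counts pairs, whereas the empirical mean averages over agents. A pair yields one
-- observation of `f x y` if `x ≠ y` and two if `x = y`, so the two counts agree up to a factor `2`.
-- For this direction, each pair is sent to one of its observers; disjointness of the pairs makes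
-- the map injective.
open Classical in
theorem IsMatchingOn.card_pairs_le (hX : IsMatchingOn A X) (c : I ⊕ J → C) (x y : C) :
    (X.filter fun q => (c (Sum.inl q.1) = x ∧ c (Sum.inr q.2) = y) ∨
      (c (Sum.inl q.1) = y ∧ c (Sum.inr q.2) = x)).card ≤ (observers c A X x y).card := by
  refine Finset.card_le_card_of_injOn
    (fun q => if c (Sum.inl q.1) = x ∧ c (Sum.inr q.2) = y then Sum.inl q.1 else Sum.inr q.2)
    ?_ ?_
  · rintro ⟨i, j⟩ hq
    simp only [Finset.coe_filter, Set.mem_ofPred_eq] at hq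
    obtain ⟨hq, h⟩ := hq
    have hA := hX.1 _ hq
    simp only [Finset.mem_coe, mem_observers]
    split_ifs with h'
    · simp [hX.partner_inl hq, h', hA]
    · have := h.resolve_left h'
      simp [hX.partner_inr hq, this, hA]
  · rintro ⟨i, j⟩ hq ⟨i', j'⟩ hq' heq
    simp only [Finset.coe_filter, Set.mem_ofPred_eq] at hq hq'
    by_contra hne
    have := hX.2 _ hq.1 _ hq'.1 hne
    dsimp only at heq this
    split_ifs at heq <;> simp_all

open Classical in
theorem IsMatchingOn.card_observers_le (hX : IsMatchingOn A X) (c : I ⊕ J → C) (x y : C) :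
    (observers c A X x y).card ≤
      2 * (X.filter fun q => (c (Sum.inl q.1) = x ∧ c (Sum.inr q.2) = y) ∨
        (c (Sum.inl q.1) = y ∧ c (Sum.inr q.2) = x)).card := by
  set F := X.filter fun q => (c (Sum.inl q.1) = x ∧ c (Sum.inr q.2) = y) ∨
        (c (Sum.inl q.1) = y ∧ c (Sum.inr q.2) = x) with hF
  have hsub : observers c A X x y ⊆
      F.image (fun q => Sum.inl q.1) ∪ F.image (fun q => Sum.inr q.2) := by
    intro a ha
    rw [mem_observers] at ha
    obtain ⟨-, hne, h1, h2⟩ := ha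
    rcases hX.partner_cases a with h | ⟨⟨i, j⟩, hq, ⟨rfl, h⟩ | ⟨rfl, h⟩⟩
    · exact absurd h hne
    · rw [h] at h2
      exact Finset.mem_union_left _ (Finset.mem_image.2
        ⟨(i, j), Finset.mem_filter.2 ⟨hq, Or.inl ⟨h1, h2⟩⟩, rfl⟩)
    · rw [h] at h2
      exact Finset.mem_union_right _ (Finset.mem_image.2
        ⟨(i, j), Finset.mem_filter.2 ⟨hq, Or.inr ⟨h2, h1⟩⟩, rfl⟩)
  refine (Finset.card_le_card hsub).trans ((Finset.card_union_le _ _).trans ?_)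
  have h1 := Finset.card_image_le (s := F) (f := fun q => (Sum.inl q.1 : I ⊕ J))
  have h2 := Finset.card_image_le (s := F) (f := fun q => (Sum.inr q.2 : I ⊕ J))
  omega

theorem card_observers_le_card (c : I ⊕ J → C) (x y : C) :
    (observers c A X x y).card ≤ A.card :=
  Finset.card_le_card fun _ ha => (mem_observers.1 ha).1

-- Each matched agent observes exactly one ordered pair of types.
open Classical in
theorem sum_card_observers_le [Fintype C] (c : I ⊕ J → C) :
    ∑ q : C × C, (observers c A X q.1 q.2).card ≤ A.card := by
  have h := Finset.card_eq_sum_card_fiberwise (s := A.filter fun a => partner X a ≠ a)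
    (t := (Finset.univ : Finset (C × C))) (f := fun a => (c a, c (partner X a)))
    (fun _ _ => by simp)
  refine le_trans (le_of_eq ?_) (h.symm.le.trans (Finset.card_filter_le _ _))
  refine Finset.sum_congr rfl fun q _ => congrArg _ ?_
  ext a
  simp [mem_observers, Prod.ext_iff, and_assoc]

open Classical in
theorem IsMatchingOn.sum_typedUtility_sub [Fintype C] (hX : IsMatchingOn A X) (c : I ⊕ J → C)
    (f v : C → C → ℝ) :
    ∑ a ∈ A, (typedUtility c v a (partner X a) - typedUtility c f a (partner X a)) =
      ∑ q : C × C, (observers c A X q.1 q.2).card * (v q.1 q.2 - f q.1 q.2) := by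
  have h1 : ∑ a ∈ A, (typedUtility c v a (partner X a) - typedUtility c f a (partner X a)) =
      ∑ a ∈ A.filter (fun a => partner X a ≠ a),
        (v (c a) (c (partner X a)) - f (c a) (c (partner X a))) := by
    rw [Finset.sum_filter]
    refine Finset.sum_congr rfl fun a _ => ?_
    rcases hX.typedUtility_partner c f a with ⟨h, h'⟩ | ⟨h, h'⟩
    · rw [if_neg (by simpa using h), h, typedUtility_self, typedUtility_self, sub_zero]
    · rcases hX.typedUtility_partner c v a with ⟨h2, -⟩ | ⟨-, h2⟩
      · exact absurd h2 h
      · rw [if_pos h, h', h2]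
  rw [h1, ← Finset.sum_fiberwise_of_maps_to (t := (Finset.univ : Finset (C × C)))
    (g := fun a => (c a, c (partner X a))) (fun _ _ => by simp)]
  refine Finset.sum_congr rfl fun q _ => ?_
  have hs : ((A.filter fun a => partner X a ≠ a).filter fun a => (c a, c (partner X a)) = q) =
      observers c A X q.1 q.2 := by
    ext a
    simp [mem_observers, Prod.ext_iff, and_assoc]
  rw [hs, ← nsmul_eq_mul, ← Finset.sum_const]
  refine Finset.sum_congr rfl fun a ha => ?_
  rw [mem_observers] at ha
  rw [ha.2.2.1, ha.2.2.2]

theorem feedback_of_mem_observers {c : I ⊕ J → C} {f : C → C → ℝ} {x y : C} {e : I ⊕ J → ℝ}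
    {a : I ⊕ J} (hX : IsMatchingOn A X) (ha : a ∈ observers c A X x y) :
    feedback (typedUtility c f) X e a = f x y + e a := by
  rw [mem_observers] at ha
  rcases hX.typedUtility_partner c f a with ⟨h, -⟩ | ⟨-, h⟩
  · exact absurd h ha.2.1
  · rw [feedback, h, ha.2.2.1, ha.2.2.2]

end Observers

/-! ### Independence of the noise from the past -/

section Past

variable {I : Type u₁} {J : Type u₂} {Ω : Type u₄} {T : ℕ} {ε : I ⊕ J → Fin T → Ω → ℝ}

theorem past_le [mΩ : MeasurableSpace Ω] (hε : ∀ a t, Measurable (ε a t)) (t : Fin T) :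
    past ε t ≤ mΩ :=
  iSup_le fun s => iSup_le fun _ => iSup_le fun a => (hε a s).comap_le

theorem measurable_past {s t : Fin T} (h : s < t) (a : I ⊕ J) : Measurable[past ε t] (ε a s) := by
  refine Measurable.of_comap_le ?_
  exact le_iSup_of_le s (le_iSup_of_le h (le_iSup_of_le a le_rfl))

theorem past_mono {s t : Fin T} (h : s ≤ t) : past ε s ≤ past ε t :=
  iSup_le fun r => iSup_le fun hr => le_iSup_of_le r (le_iSup_of_le (hr.trans_le h) le_rfl)

theorem indep_past [MeasurableSpace Ω] {μ : Measure Ω} (hε : ∀ a t, Measurable (ε a t))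
    (hind : iIndepFun (fun q : (I ⊕ J) × Fin T => ε q.1 q.2) μ) (t : Fin T) :
    Indep (past ε t) (⨆ a, (borel ℝ).comap (ε a t)) μ := by
  have h := indep_iSup_of_disjoint (m := fun q : (I ⊕ J) × Fin T => (borel ℝ).comap (ε q.1 q.2))
    (fun q => (hε q.1 q.2).comap_le) hind (S := {q | q.2 < t}) (T := {q | q.2 = t})
    (Set.disjoint_left.2 fun q h1 h2 => by
      simp only [Set.mem_ofPred_eq] at h1 h2; exact absurd h2 h1.ne)
  refine indep_of_indep_of_le_left (indep_of_indep_of_le_right h ?_) ?_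
  · exact iSup_le fun a => le_iSup_of_le (a, t) (le_iSup_of_le rfl le_rfl)
  · exact iSup_le fun s => iSup_le fun hs => iSup_le fun a =>
      le_iSup_of_le (a, s) (le_iSup_of_le hs le_rfl)

end Past

/-! ### Concentration of noise with predictable observers -/

section Martingale

variable {I : Type u₁} {J : Type u₂} {Ω : Type u₄} {T : ℕ}

/-- The number of observations made in the first `k` rounds, if `O s` are the observers of
round `s`. -/
def observationCount (O : Fin T → Ω → Finset (I ⊕ J)) (k : ℕ) (ω : Ω) : ℕ :=
  ∑ s ∈ Finset.univ.filter (fun s : Fin T => s.val < k), (O s ω).card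

/-- The total noise in the observations made in the first `k` rounds. -/
def observationNoise (ε : I ⊕ J → Fin T → Ω → ℝ) (O : Fin T → Ω → Finset (I ⊕ J)) (k : ℕ)
    (ω : Ω) : ℝ :=
  ∑ s ∈ Finset.univ.filter (fun s : Fin T => s.val < k), ∑ a ∈ O s ω, ε a s ω

theorem filter_val_lt_succ {k : ℕ} (hk : k < T) :
    Finset.univ.filter (fun s : Fin T => s.val < k + 1) =
      insert ⟨k, hk⟩ (Finset.univ.filter fun s : Fin T => s.val < k) := by
  ext s
  simp only [Finset.mem_filter, Finset.mem_univ, true_and, Finset.mem_insert, Fin.ext_iff]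
  omega

theorem sum_filter_val_lt_succ {M : Type*} [AddCommMonoid M] (g : Fin T → M) {k : ℕ} (hk : k < T) :
    ∑ s ∈ Finset.univ.filter (fun s : Fin T => s.val < k + 1), g s =
      (∑ s ∈ Finset.univ.filter (fun s : Fin T => s.val < k), g s) + g ⟨k, hk⟩ := by
  rw [filter_val_lt_succ hk, Finset.sum_insert (by simp), add_comm]

/-- The exponential supermartingale of the noise. -/
def expNoise (ε : I ⊕ J → Fin T → Ω → ℝ) (O : Fin T → Ω → Finset (I ⊕ J)) (r : ℝ) (k : ℕ)
    (ω : Ω) : ENNReal :=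
  ENNReal.ofReal (Real.exp (r * observationNoise ε O k ω - r ^ 2 / 2 * observationCount O k ω))

variable {ε : I ⊕ J → Fin T → Ω → ℝ} {O : Fin T → Ω → Finset (I ⊕ J)}

/-- Functions of a measurable choice among finitely many possibilities are measurable. -/
theorem measurable_comp_of_finite {γ β : Type*} [Finite γ] [MeasurableSpace β]
    {m : MeasurableSpace Ω} {Y : Ω → γ} (hY : ∀ y, MeasurableSet[m] {ω | Y ω = y}) (g : γ → β) :
    Measurable[m] fun ω => g (Y ω) := by
  let : MeasurableSpace γ := ⊤
  have h : Measurable[m] Y := measurable_to_countable' hY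
  exact measurable_from_top.comp h

/-- For a deterministic set `Y` the noise sum is subgaussian with parameter `|Y|`, and the
normalisation cancels the moment bound exactly. -/
theorem lintegral_exp_sum_noise_le [MeasurableSpace Ω] {μ : Measure Ω}
    (hind : iIndepFun (fun q : (I ⊕ J) × Fin T => ε q.1 q.2) μ)
    (hsub : ∀ a t, HasSubgaussianMGF (ε a t) 1 μ) (r : ℝ) (t : Fin T) (Y : Finset (I ⊕ J)) :
    ∫⁻ ω, ENNReal.ofReal (Real.exp (r * ∑ a ∈ Y, ε a t ω - r ^ 2 / 2 * Y.card)) ∂μ ≤ 1 := by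
  have hi : iIndepFun (fun a : I ⊕ J => ε a t) μ :=
    hind.precomp (g := fun a : I ⊕ J => (a, t)) fun a b h => congrArg Prod.fst h
  have h := HasSubgaussianMGF.sum_of_iIndepFun hi (c := fun _ => 1) (s := Y)
    fun a _ => hsub a t
  have heq : ∀ ω, Real.exp (r * ∑ a ∈ Y, ε a t ω - r ^ 2 / 2 * Y.card) =
      Real.exp (r * ∑ a ∈ Y, ε a t ω) * Real.exp (-(r ^ 2 / 2 * Y.card)) := fun ω => by
    rw [← Real.exp_add, sub_eq_add_neg]
  simp_rw [heq]
  rw [← ofReal_integral_eq_lintegral_ofReal ((h.integrable_exp_mul r).mul_const _)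
    (ae_of_all _ fun ω => by positivity), integral_mul_const]
  have h2 := h.mgf_le r
  rw [ENNReal.ofReal_le_one]
  calc _ ≤ Real.exp (((∑ a ∈ Y, 1 : NNReal) : ℝ) * r ^ 2 / 2) *
        Real.exp (-(r ^ 2 / 2 * Y.card)) := by
        gcongr
        exact h2
    _ = 1 := by
        rw [← Real.exp_add, Real.exp_eq_one_iff]
        simp only [Finset.sum_const, nsmul_eq_mul, mul_one, NNReal.coe_natCast]
        ring

variable [Fintype I] [Fintype J]

open Classical in
theorem measurable_sum_observers (hO : ∀ t Y, MeasurableSet[past ε t] {ω | O t ω = Y})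
    {m : MeasurableSpace Ω} {t : Fin T} (hm : past ε t ≤ m)
    (hε : ∀ a, Measurable[m] (ε a t)) : Measurable[m] fun ω => ∑ a ∈ O t ω, ε a t ω := by
  have h : (fun ω => ∑ a ∈ O t ω, ε a t ω) =
      fun ω => ∑ a, (if a ∈ O t ω then 1 else 0) * ε a t ω := by
    ext ω
    simp [Finset.sum_ite_mem]
  rw [h]
  refine Finset.measurable_sum _ fun a _ => Measurable.mul ?_ (hε a)
  exact (measurable_comp_of_finite (hO t) (fun Y => if a ∈ Y then (1 : ℝ) else 0)).mono hm le_rfl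

theorem measurable_observationCount (hO : ∀ t Y, MeasurableSet[past ε t] {ω | O t ω = Y})
    {m : MeasurableSpace Ω} {k : ℕ} (hm : ∀ s : Fin T, s.val < k → past ε s ≤ m) :
    Measurable[m] (observationCount O k) := by
  refine Finset.measurable_sum _ fun s hs => ?_
  exact (measurable_comp_of_finite (hO s) Finset.card).mono (hm s (by simpa using hs)) le_rfl

theorem measurable_observationNoise (hO : ∀ t Y, MeasurableSet[past ε t] {ω | O t ω = Y})
    {m : MeasurableSpace Ω} {k : ℕ} (hm : ∀ s : Fin T, s.val < k → past ε s ≤ m)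
    (hε : ∀ s : Fin T, s.val < k → ∀ a, Measurable[m] (ε a s)) :
    Measurable[m] (observationNoise ε O k) := by
  refine Finset.measurable_sum _ fun s hs => ?_
  have hs' : s.val < k := by simpa using hs
  exact measurable_sum_observers hO (hm s hs') (hε s hs')

theorem measurable_expNoise (hO : ∀ t Y, MeasurableSet[past ε t] {ω | O t ω = Y})
    {m : MeasurableSpace Ω} {k : ℕ} (hm : ∀ s : Fin T, s.val < k → past ε s ≤ m)
    (hε : ∀ s : Fin T, s.val < k → ∀ a, Measurable[m] (ε a s)) (r : ℝ) :
    Measurable[m] (expNoise ε O r k) := by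
  have h1 := measurable_observationCount hO hm
  have h2 := measurable_observationNoise hO hm hε
  have h3 : Measurable[m] fun ω => (observationCount O k ω : ℝ) :=
    (measurable_from_top (f := fun i : ℕ => (i : ℝ))).comp h1
  exact ((h2.const_mul r).sub (h3.const_mul _)).exp.ennreal_ofReal

variable [mΩ : MeasurableSpace Ω] {μ : Measure Ω} [IsProbabilityMeasure μ]

-- Supermartingale step: splitting over the finitely many values `Y` of the observer set makes the
-- new factor depend on round-`t` noise only. It is then independent of the past and has expectation
-- at most `1`.
open Classical in
theorem lintegral_expNoise_le (hε : ∀ a t, Measurable (ε a t))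
    (hind : iIndepFun (fun q : (I ⊕ J) × Fin T => ε q.1 q.2) μ)
    (hsub : ∀ a t, HasSubgaussianMGF (ε a t) 1 μ)
    (hO : ∀ t Y, MeasurableSet[past ε t] {ω | O t ω = Y}) (r : ℝ) {k : ℕ} (hk : k ≤ T) :
    ∫⁻ ω, expNoise ε O r k ω ∂μ ≤ 1 := by
  induction k with
  | zero => simp [expNoise, observationNoise, observationCount]
  | succ k ih =>
    have hkT : k < T := hk
    set t : Fin T := ⟨k, hkT⟩ with ht
    set Z : Ω → ENNReal := expNoise ε O r k with hZ
    set G : Finset (I ⊕ J) → Ω → ENNReal := fun Y ω =>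
      ENNReal.ofReal (Real.exp (r * ∑ a ∈ Y, ε a t ω - r ^ 2 / 2 * Y.card)) with hG
    -- `D Y` is the past-measurable factor, supported on the event that `Y` is the observer set;
    -- summing over `Y` restores `Z`.
    set D : Finset (I ⊕ J) → Ω → ENNReal := fun Y ω => (if O t ω = Y then 1 else 0) * Z ω with hD
    have hstep : ∀ ω, expNoise ε O r (k + 1) ω = ∑ Y, D Y ω * G Y ω := by
      intro ω
      rw [Finset.sum_eq_single (O t ω) (fun Y _ hY => by simp [hD, hY.symm]) (by simp)]
      simp only [hD, hG, hZ, if_true, one_mul, expNoise]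
      rw [← ENNReal.ofReal_mul (Real.exp_nonneg _), ← Real.exp_add]
      congr 2
      rw [observationNoise, observationCount, sum_filter_val_lt_succ _ hkT,
        sum_filter_val_lt_succ _ hkT]
      simp only [observationNoise, observationCount]
      push_cast
      ring
    have hsum : ∀ ω, ∑ Y, D Y ω = Z ω := by
      intro ω
      simp [hD]
    have hDm : ∀ Y, Measurable[past ε t] (D Y) := by
      intro Y
      refine Measurable.mul
        (measurable_comp_of_finite (hO t) (fun Y' => if Y' = Y then (1 : ENNReal) else 0)) ?_
      refine measurable_expNoise hO (fun s hs => past_mono (le_of_lt ?_))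
        (fun s hs a => measurable_past ?_ a) r <;> exact hs
    have hGm : ∀ Y, Measurable[⨆ a, (borel ℝ).comap (ε a t)] (G Y) := by
      intro Y
      have h1 : ∀ a, Measurable[⨆ a, (borel ℝ).comap (ε a t)] (ε a t) := fun a =>
        Measurable.of_comap_le (le_iSup (fun a => (borel ℝ).comap (ε a t)) a)
      exact (((Finset.measurable_sum Y fun a _ => h1 a).const_mul r).sub_const
        _).exp.ennreal_ofReal
    have hle : ∀ Y, ∫⁻ ω, D Y ω * G Y ω ∂μ ≤ ∫⁻ ω, D Y ω ∂μ := by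
      intro Y
      rw [lintegral_mul_eq_lintegral_mul_lintegral_of_independent_measurableSpace (past_le hε t)
        (iSup_le fun a => (hε a t).comap_le) (indep_past hε hind t) (hDm Y) (hGm Y)]
      exact mul_le_of_le_one_right' (lintegral_exp_sum_noise_le hind hsub r t Y)
    have hDm' : ∀ Y, Measurable (D Y) := fun Y => (hDm Y).mono (past_le hε t) le_rfl
    have hGm' : ∀ Y, Measurable (G Y) := fun Y =>
      (hGm Y).mono (iSup_le fun a => (hε a t).comap_le) le_rfl
    simp_rw [hstep]
    rw [lintegral_finsetSum (f := fun Y ω => D Y ω * G Y ω) _ fun Y _ => (hDm' Y).mul (hGm' Y)]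
    refine (Finset.sum_le_sum fun Y _ => hle Y).trans ?_
    rw [← lintegral_finsetSum _ fun Y _ => hDm' Y]
    simp_rw [hsum]
    exact ih (by omega)

/-- Chernoff bound for a given number of observations. -/
theorem measure_observationNoise_ge_le (hε : ∀ a t, Measurable (ε a t))
    (hind : iIndepFun (fun q : (I ⊕ J) × Fin T => ε q.1 q.2) μ)
    (hsub : ∀ a t, HasSubgaussianMGF (ε a t) 1 μ)
    (hO : ∀ t Y, MeasurableSet[past ε t] {ω | O t ω = Y}) {k : ℕ} (hk : k ≤ T) {m : ℕ}
    (hm : 0 < m) {L : ℝ} (hL : 0 ≤ L) {σ : ℝ} (hσ : σ ^ 2 = 1) :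
    μ {ω | observationCount O k ω = m ∧ 8 * √(m * L) < σ * observationNoise ε O k ω} ≤
      ENNReal.ofReal (Real.exp (-(32 * L))) := by
  -- This choice, with `σ = ±1` selecting the tail, maximises the exponent `8 |r| √(mL) - r² m / 2`,
  -- with value `64 L - 32 L = 32 L`. Fixing the count `m` keeps `r` deterministic.
  set r : ℝ := σ * (8 * √(L / m)) with hr
  have hmR : (0 : ℝ) < m := by exact_mod_cast hm
  have hZm : Measurable (expNoise ε O r k) :=
    measurable_expNoise hO (fun s _ => past_le hε s) (fun s _ a => hε a s) r
  have hsubset : {ω | observationCount O k ω = m ∧ 8 * √(m * L) < σ * observationNoise ε O k ω} ⊆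
      {ω | ENNReal.ofReal (Real.exp (32 * L)) ≤ expNoise ε O r k ω} := by
    rintro ω ⟨h1, h2⟩
    refine ENNReal.ofReal_le_ofReal (Real.exp_le_exp.2 ?_)
    rw [h1]
    have h3 : √(L / m) * √(m * L) = L := by
      rw [← Real.sqrt_mul (by positivity), show L / m * (m * L) = L ^ 2 by field_simp,
        Real.sqrt_sq hL]
    have h4 : r ^ 2 / 2 * m = 32 * L := by
      rw [hr, mul_pow, mul_pow, hσ, Real.sq_sqrt (by positivity)]
      field_simp
      ring
    have h5 : 8 * √(L / m) * (8 * √(m * L)) ≤ 8 * √(L / m) * (σ * observationNoise ε O k ω) :=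
      mul_le_mul_of_nonneg_left h2.le (by positivity)
    have h6 : r * observationNoise ε O k ω =
        8 * √(L / m) * (σ * observationNoise ε O k ω) := by rw [hr]; ring
    rw [h6, h4]
    nlinarith
  have h1 := (mul_meas_ge_le_lintegral (μ := μ) hZm (ENNReal.ofReal (Real.exp (32 * L)))).trans
    (lintegral_expNoise_le hε hind hsub hO r hk)
  rw [Real.exp_neg, ENNReal.ofReal_inv_of_pos (Real.exp_pos _)]
  refine (measure_mono hsubset).trans ?_
  rw [ENNReal.le_inv_iff_mul_le, mul_comm]
  exact h1

/-- Concentration of the noise, uniformly over the possible numbers of observations. -/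
theorem measure_observationNoise_abs_gt_le (hε : ∀ a t, Measurable (ε a t))
    (hind : iIndepFun (fun q : (I ⊕ J) × Fin T => ε q.1 q.2) μ)
    (hsub : ∀ a t, HasSubgaussianMGF (ε a t) 1 μ)
    (hO : ∀ t Y, MeasurableSet[past ε t] {ω | O t ω = Y}) {k : ℕ} (hk : k ≤ T)
    {L : ℝ} (hL : 0 ≤ L) :
    μ {ω | 0 < observationCount O k ω ∧
        8 * √(observationCount O k ω * L) < |observationNoise ε O k ω|} ≤
      ENNReal.ofReal (Fintype.card (I ⊕ J) * T * (2 * Real.exp (-(32 * L)))) := by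
  set M := Fintype.card (I ⊕ J) * T with hM
  have hcount : ∀ ω, observationCount O k ω ≤ M := by
    intro ω
    calc observationCount O k ω
        ≤ ∑ s ∈ Finset.univ.filter (fun s : Fin T => s.val < k), Fintype.card (I ⊕ J) :=
          Finset.sum_le_sum fun s _ => Finset.card_le_univ _
      _ ≤ ∑ s : Fin T, Fintype.card (I ⊕ J) :=
          Finset.sum_le_sum_of_subset (Finset.filter_subset _ _)
      _ = M := by simp [hM, mul_comm]
  set E : ℕ → ℝ → Set Ω := fun m σ =>
    {ω | observationCount O k ω = m ∧ 8 * √(m * L) < σ * observationNoise ε O k ω} with hE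
  have hsubset : {ω | 0 < observationCount O k ω ∧
        8 * √(observationCount O k ω * L) < |observationNoise ε O k ω|} ⊆
      -- The number of observations is random, hence a union over all its positive values and both
      -- signs.
      ⋃ m ∈ Finset.Icc 1 M, (E m 1 ∪ E m (-1)) := by
    rintro ω ⟨h1, h2⟩
    simp only [Set.mem_iUnion]
    refine ⟨observationCount O k ω, Finset.mem_Icc.2 ⟨h1, hcount ω⟩, ?_⟩
    rcases lt_abs.1 h2 with h | h
    · exact Or.inl ⟨rfl, by simpa using h⟩
    · exact Or.inr ⟨rfl, by simpa using h⟩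
  refine (measure_mono hsubset).trans ((measure_biUnion_finset_le _ _).trans ?_)
  have hterm : ∀ m ∈ Finset.Icc 1 M, μ (E m 1 ∪ E m (-1)) ≤
      ENNReal.ofReal (2 * Real.exp (-(32 * L))) := by
    intro m hm
    have hm' : 0 < m := (Finset.mem_Icc.1 hm).1
    refine (measure_union_le _ _).trans ?_
    rw [two_mul, ENNReal.ofReal_add (Real.exp_nonneg _) (Real.exp_nonneg _)]
    exact add_le_add
      (measure_observationNoise_ge_le hε hind hsub hO hk hm' hL (by norm_num))
      (measure_observationNoise_ge_le hε hind hsub hO hk hm' hL (by norm_num))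
  refine (Finset.sum_le_sum hterm).trans ?_
  rw [Finset.sum_const, Nat.card_Icc, nsmul_eq_mul, Nat.add_sub_cancel,
    ← Nat.cast_mul, ENNReal.ofReal_mul (p := (M : ℝ)) (by positivity), ENNReal.ofReal_natCast]

end Martingale

/-! ### Summing widths over batches -/

section Potential

/-- The potential `2 min(s, 2n) + 64 √L √s` pays for a batch of size `m ≤ n`. If `s ≤ n`, then `s +
m ≤ 2n` and the first term grows by `2m`. If `s > n`, the batch less than doubles `s`, so `m / √s`
is comparable to `√(s + m) - √s` and the second term pays. -/
theorem potential_step {s m n L g : ℝ} (hs : 0 ≤ s) (hm : 0 ≤ m) (hmn : m ≤ n) (hL : 0 ≤ L)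
    (hg : g ≤ 2) (hg' : 0 < s → g ≤ 16 * √(2 * L / s)) :
    2 * min s (2 * n) + 64 * √L * √s + m * g ≤
      2 * min (s + m) (2 * n) + 64 * √L * √(s + m) := by
  rcases le_or_gt s n with h | h
  · rw [min_eq_left (by linarith), min_eq_left (by linarith)]
    have h1 : √s ≤ √(s + m) := Real.sqrt_le_sqrt (by linarith)
    have h2 := mul_le_mul_of_nonneg_left h1 (by positivity : 0 ≤ 64 * √L)
    nlinarith
  · have hs0 : 0 < s := by linarith
    have h1 : min s (2 * n) ≤ min (s + m) (2 * n) := min_le_min_right _ (by linarith)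
    set p := √(s + m) with hp
    set q := √s with hq
    have hq0 : 0 < q := Real.sqrt_pos.2 hs0
    have hq2 : q ^ 2 = s := Real.sq_sqrt hs
    have hp2 : p ^ 2 = s + m := Real.sq_sqrt (by linarith)
    have hqp : q ≤ p := Real.sqrt_le_sqrt (by linarith)
    have h2 : √2 ^ 2 = 2 := Real.sq_sqrt (by norm_num)
    have h2' : (0 : ℝ) ≤ √2 := Real.sqrt_nonneg _
    have h2'' : √2 ≤ 2 := by nlinarith
    have hpq : p ≤ √2 * q := by
      refine abs_le_of_sq_le_sq' ?_ (by positivity) |>.2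
      rw [mul_pow, h2]
      linarith
    have hroot : √(2 * L / s) = √2 * √L / q := by
      rw [Real.sqrt_div (by positivity), Real.sqrt_mul (by norm_num)]
    -- Here `m = (p - q)(p + q)`, and `p ≤ √2 q` gives `√2 (p + q) ≤ (2 + √2) q ≤ 4 q`.
    have h3 : m * √2 ≤ 4 * (p - q) * q := by
      have h4 : (p + q) * √2 ≤ 4 * q := by nlinarith
      have h5 : m = (p - q) * (p + q) := by nlinarith
      rw [h5]
      nlinarith [mul_le_mul_of_nonneg_left h4 (sub_nonneg.2 hqp)]
    have h6 : m * g ≤ 64 * √L * (p - q) := by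
      refine (mul_le_mul_of_nonneg_left (hg' hs0) hm).trans ?_
      rw [hroot, show m * (16 * (√2 * √L / q)) = 16 * √L * ((m * √2) / q) by ring,
        show 64 * √L * (p - q) = 16 * √L * (4 * (p - q)) by ring]
      refine mul_le_mul_of_nonneg_left ?_ (by positivity)
      rwa [div_le_iff₀ hq0]
    linarith

/-- Summing widths `g t ≤ 16 √(2 L / N)`, where `N` is the number of earlier observations, when
the observations arrive in batches of at most `n`. -/
theorem sum_batch_le {T : ℕ} {o : Fin T → ℕ} {g : Fin T → ℝ} {n : ℕ} {L : ℝ} (hL : 0 ≤ L)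
    (ho : ∀ t, o t ≤ n) (hg : ∀ t, g t ≤ 2)
    (hg' : ∀ t : Fin T, 0 < ∑ s ∈ Finset.univ.filter (fun s : Fin T => s.val < t.val), o s →
      g t ≤ 16 * √(2 * L /
        (∑ s ∈ Finset.univ.filter (fun s : Fin T => s.val < t.val), o s : ℕ))) :
    ∑ t, o t * g t ≤ 4 * n + 64 * √L * √(∑ s, o s : ℕ) := by
  have key : ∀ k ≤ T, ∑ t ∈ Finset.univ.filter (fun s : Fin T => s.val < k), o t * g t ≤
      2 * min ((∑ s ∈ Finset.univ.filter (fun s : Fin T => s.val < k), o s : ℕ) : ℝ) (2 * n) +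
        64 * √L * √(∑ s ∈ Finset.univ.filter (fun s : Fin T => s.val < k), o s : ℕ) := by
    intro k
    induction k with
    | zero => intro _; simp
    | succ k ih =>
      intro hk
      have hkT : k < T := hk
      rw [sum_filter_val_lt_succ _ hkT, sum_filter_val_lt_succ _ hkT, Nat.cast_add]
      have h := potential_step (s := (∑ s ∈ Finset.univ.filter (fun s : Fin T => s.val < k),
        o s : ℕ)) (m := o ⟨k, hkT⟩) (n := n) (g := g ⟨k, hkT⟩) (Nat.cast_nonneg _)
        (Nat.cast_nonneg _) (by exact_mod_cast ho _) hL (hg _)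
        fun h => hg' ⟨k, hkT⟩ (by exact_mod_cast h)
      linarith [ih hkT.le]
  have h := key T le_rfl
  have huniv : Finset.univ.filter (fun s : Fin T => s.val < T) = Finset.univ := by
    simp
  rw [huniv] at h
  refine h.trans ?_
  have := min_le_right ((∑ s, o s : ℕ) : ℝ) (2 * n)
  linarith

end Potential

/-! ### Validity and width of the confidence bounds -/

section Confidence

variable {I : Type u₁} {J : Type u₂} {C : Type u₃} {T : ℕ}

theorem Iio_eq_filter_val_lt (t : Fin T) :
    Finset.Iio t = Finset.univ.filter fun s : Fin T => s.val < t.val := by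
  ext s
  simp

/-- The number of observations of `f (x, y)` before round `k`. -/
def typeCount (c : I ⊕ J → C) (A : Fin T → Finset (I ⊕ J)) (X : Fin T → Finset (I × J)) (k : ℕ)
    (x y : C) : ℕ :=
  ∑ s ∈ Finset.univ.filter (fun s : Fin T => s.val < k), (observers c (A s) (X s) x y).card

/-- The total noise in the observations of `f (x, y)` before round `k`. -/
def typeNoise (c : I ⊕ J → C) (A : Fin T → Finset (I ⊕ J)) (X : Fin T → Finset (I × J))
    (e : I ⊕ J → Fin T → ℝ) (k : ℕ) (x y : C) : ℝ :=
  ∑ s ∈ Finset.univ.filter (fun s : Fin T => s.val < k), ∑ a ∈ observers c (A s) (X s) x y, e a s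

variable {c : I ⊕ J → C} {A : Fin T → Finset (I ⊕ J)} {X : Fin T → Finset (I × J)}
  {e : I ⊕ J → Fin T → ℝ}

theorem matchCount_le_typeCount (hX : ∀ t, IsMatchingOn (A t) (X t)) (t : Fin T) (x y : C) :
    matchCount c X t x y ≤ typeCount c A X t x y := by
  rw [matchCount, typeCount, ← Iio_eq_filter_val_lt]
  exact Finset.sum_le_sum fun s _ => (hX s).card_pairs_le c x y

theorem typeCount_le_two_mul_matchCount (hX : ∀ t, IsMatchingOn (A t) (X t)) (t : Fin T)
    (x y : C) : typeCount c A X t x y ≤ 2 * matchCount c X t x y := by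
  rw [matchCount, typeCount, ← Iio_eq_filter_val_lt, Finset.mul_sum]
  exact Finset.sum_le_sum fun s _ => (hX s).card_observers_le c x y

theorem empiricalMean_eq (hX : ∀ t, IsMatchingOn (A t) (X t)) (f : C → C → ℝ) (t : Fin T)
    (x y : C) (h : 0 < typeCount c A X t x y) :
    empiricalMean c (typedUtility c f) A X e t x y =
      f x y + typeNoise c A X e t x y / typeCount c A X t x y := by
  have hR : (typeCount c A X t x y : ℝ) ≠ 0 := by exact_mod_cast h.ne'
  have h1 : ∑ s ∈ Finset.Iio t, ∑ a ∈ observers c (A s) (X s) x y,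
      feedback (typedUtility c f) (X s) (fun b => e b s) a =
      typeCount c A X t x y * f x y + typeNoise c A X e t x y := by
    rw [typeCount, typeNoise, Iio_eq_filter_val_lt, Nat.cast_sum, Finset.sum_mul,
      ← Finset.sum_add_distrib]
    refine Finset.sum_congr rfl fun s _ => ?_
    rw [Finset.sum_congr rfl fun a ha => feedback_of_mem_observers (hX s) ha,
      Finset.sum_add_distrib, Finset.sum_const, nsmul_eq_mul]
  rw [empiricalMean, h1, Iio_eq_filter_val_lt, ← typeCount]
  field_simp

/-- The noise of all observations made so far is within the confidence radius. -/
def IsConcentrated (c : I ⊕ J → C) (A : Fin T → Finset (I ⊕ J)) (X : Fin T → Finset (I × J))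
    (e : I ⊕ J → Fin T → ℝ) (L : ℝ) : Prop :=
  ∀ (t : Fin T) (a b : I ⊕ J), 0 < typeCount c A X t (c a) (c b) →
    |typeNoise c A X e t (c a) (c b)| ≤ 8 * √(typeCount c A X t (c a) (c b) * L)

/-- Observed types are carried by agents, so concentration is needed only for types of agents. The
union bound thus runs over pairs of agents, however large `C` is. -/
theorem exists_types_of_typeCount_pos {k : ℕ} {x y : C} (h : 0 < typeCount c A X k x y) :
    ∃ a b, c a = x ∧ c b = y := by
  obtain ⟨s, -, hs⟩ := Finset.exists_ne_zero_of_sum_ne_zero h.ne'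
  obtain ⟨a, ha⟩ := Finset.card_ne_zero.1 hs
  rw [mem_observers] at ha
  exact ⟨a, _, ha.2.2.1, ha.2.2.2⟩

/-- With `k` matched pairs and `M` observations, `k ≤ M` puts the averaged noise within the radius
`8 √(L/k)`, and `M ≤ 2k` bounds the full width `16 √(L/k)` by `16 √(2L/M)`. -/
theorem IsConcentrated.upperConfidence {N : ℕ}
    (hc : IsConcentrated c A X e (Real.log (N * T))) (hL : 0 ≤ Real.log (N * T))
    (hX : ∀ t, IsMatchingOn (A t) (X t)) {f : C → C → ℝ}
    (hf : ∀ x y, f x y ∈ Set.Icc (-1 : ℝ) 1) {t : Fin T} {x y : C} {v : ℝ}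
    (hv : IsUpperConfidence (confidenceSet N T (matchCount c X t x y)
      (empiricalMean c (typedUtility c f) A X e t x y)) v) :
    f x y ≤ v ∧ (0 < typeCount c A X t x y →
      v - f x y ≤ 16 * √(2 * Real.log (N * T) / typeCount c A X t x y)) := by
  have h1 := matchCount_le_typeCount (c := c) hX t x y
  have h2 := typeCount_le_two_mul_matchCount (c := c) hX t x y
  rcases Nat.eq_zero_or_pos (matchCount c X t x y) with h0 | h0
  · refine ⟨?_, fun h => by omega⟩
    rw [h0, confidenceSet, if_pos rfl] at hv
    exact (hv.2 ⟨_, hf x y⟩).2 (hf x y)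
  · have hpos : 0 < typeCount c A X t x y := by omega
    rw [confidenceSet, if_neg h0.ne', empiricalMean_eq hX f t x y hpos] at hv
    obtain ⟨a, b, rfl, rfl⟩ := exists_types_of_typeCount_pos hpos
    have hconc := hc t a b hpos
    set k := matchCount c X t (c a) (c b)
    set M := typeCount c A X t (c a) (c b)
    set S := typeNoise c A X e t (c a) (c b)
    set L := Real.log (N * T)
    have hk : (0 : ℝ) < k := by exact_mod_cast h0
    have hM : (0 : ℝ) < M := by exact_mod_cast hpos
    have hkM : (k : ℝ) ≤ M := by exact_mod_cast h1
    have hMk : (M : ℝ) ≤ 2 * k := by exact_mod_cast h2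
    have hdiv : |S / M| ≤ 8 * √(L / k) := by
      rw [abs_div, abs_of_pos hM, div_le_iff₀ hM]
      refine hconc.trans ?_
      have h3 : √(M * L) = √(L / M) * M := by
        rw [show (M : ℝ) * L = L / M * M ^ 2 by field_simp, Real.sqrt_mul (by positivity),
          Real.sqrt_sq hM.le]
      have h4 : √(L / M) ≤ √(L / k) := Real.sqrt_le_sqrt (by gcongr)
      rw [h3, mul_assoc]
      gcongr
    have hwidth : √(L / k) ≤ √(2 * L / M) := by
      refine Real.sqrt_le_sqrt ?_
      rw [div_le_div_iff₀ hk hM]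
      nlinarith
    rw [abs_le] at hdiv
    -- The true value lies in the confidence set, so that set is nonempty and the arbitrary fallback
    -- value plays no role.
    have hmem : f (c a) (c b) ∈ Set.Icc (f (c a) (c b) + S / M - 8 * √(L / k))
        (f (c a) (c b) + S / M + 8 * √(L / k)) ∩ Set.Icc (-1) 1 :=
      ⟨⟨by linarith [hdiv.2], by linarith [hdiv.1]⟩, hf _ _⟩
    have hgr := hv.2 ⟨_, hmem⟩
    refine ⟨hgr.2 hmem, fun _ => ?_⟩
    have := hgr.1.1.2
    linarith [hdiv.2]

theorem sum_sqrt_typeCount_le [Fintype C] {n : ℕ}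
    (hn : ∀ t, (A t).card ≤ n) :
    ∑ q : C × C, √(∑ s, (observers c (A s) (X s) q.1 q.2).card : ℕ) ≤
      Fintype.card C * √(n * T) := by
  have h1 : ∑ q : C × C, ((∑ s, (observers c (A s) (X s) q.1 q.2).card : ℕ) : ℝ) ≤ n * T := by
    rw [← Nat.cast_sum, Finset.sum_comm]
    have : ∑ s, ∑ q : C × C, (observers c (A s) (X s) q.1 q.2).card ≤ ∑ s : Fin T, n :=
      Finset.sum_le_sum fun s _ => (sum_card_observers_le c).trans (hn s)
    calc _ ≤ ((∑ s : Fin T, n : ℕ) : ℝ) := by exact_mod_cast this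
      _ = n * T := by simp [mul_comm]
  have h2 := sq_sum_le_card_mul_sum_sq (s := (Finset.univ : Finset (C × C)))
    (f := fun q => √(∑ s, (observers c (A s) (X s) q.1 q.2).card : ℕ))
  simp only [Real.sq_sqrt (Nat.cast_nonneg _)] at h2
  refine (abs_le_of_sq_le_sq' ?_ (by positivity)).2
  refine h2.trans ?_
  rw [mul_pow, Real.sq_sqrt (by positivity), Finset.card_univ, Fintype.card_prod, Nat.cast_mul,
    ← sq]
  exact mul_le_mul_of_nonneg_left h1 (by positivity)

end Confidence

/-! ### Regret on and off the deviation event -/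

section Regret

variable {I : Type u₁} {J : Type u₂} {C : Type u₃} {Ω : Type u₄} {T : ℕ}
  {c : I ⊕ J → C} {A : Fin T → Finset (I ⊕ J)} {ε : I ⊕ J → Fin T → Ω → ℝ}
  {X : Fin T → Ω → Finset (I × J)} {τ : Fin T → Ω → I ⊕ J → ℝ} {f : C → C → ℝ} {u : Utility I J}

/-- The event that some noise sum leaves the confidence radius. -/
def deviationEvent (c : I ⊕ J → C) (A : Fin T → Finset (I ⊕ J)) (ε : I ⊕ J → Fin T → Ω → ℝ)
    (X : Fin T → Ω → Finset (I × J)) (L : ℝ) : Set Ω :=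
  {ω | ¬ IsConcentrated c A (fun s => X s ω) (fun a s => ε a s ω) L}

theorem deviationEvent_eq (L : ℝ) : deviationEvent c A ε X L =
    ⋃ q : Fin T × (I ⊕ J) × (I ⊕ J),
      {ω | 0 < observationCount (fun s ω => observers c (A s) (X s ω) (c q.2.1) (c q.2.2)) q.1 ω ∧
        8 * √(observationCount (fun s ω => observers c (A s) (X s ω) (c q.2.1) (c q.2.2)) q.1 ω
          * L) <
        |observationNoise ε (fun s ω => observers c (A s) (X s ω) (c q.2.1) (c q.2.2)) q.1 ω|} := by
  ext ω
  simp only [deviationEvent, IsConcentrated, Set.mem_ofPred_eq, Set.mem_iUnion, Prod.exists]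
  push Not
  rfl

variable [Fintype I] [Fintype J]

theorem IsMatchTypedUCBRun.measurableSet_observers (hrun : IsMatchTypedUCBRun c u A ε X τ)
    (x y : C) (t : Fin T) (Y : Finset (I ⊕ J)) :
    MeasurableSet[past ε t] {ω | observers c (A t) (X t ω) x y = Y} := by
  let : MeasurableSpace (Finset (I ⊕ J)) := ⊤
  exact measurable_comp_of_finite (hrun.matching_nonanticipating t)
    (fun Z => observers c (A t) Z x y) (MeasurableSpace.measurableSet_top (s := {Y}))

theorem regret_nonneg (ω : Ω) : 0 ≤ regret u A X τ ω :=
  Finset.sum_nonneg fun _ _ => subsetInstability_nonneg _ _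

theorem IsMatchTypedUCBRun.regret_le (hrun : IsMatchTypedUCBRun c (typedUtility c f) A ε X τ)
    (hf : ∀ x y, f x y ∈ Set.Icc (-1 : ℝ) 1) {n : ℕ} (hn : ∀ t, (A t).card ≤ n) (ω : Ω) :
    regret (typedUtility c f) A X τ ω ≤ 3 * n * T := by
  have h : ∀ t ∈ (Finset.univ : Finset (Fin T)),
      subsetInstability (A t) (typedUtility c f) (X t ω) (τ t ω) ≤ 3 * n := by
    intro t _
    obtain ⟨v, hv, hout⟩ := hrun.output t ω
    refine (hout.subsetInstability_le_card (typedUtility_mem_Icc c hf)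
      (typedUtility_mem_Icc c fun x y => (hv x y).1)).trans ?_
    have : ((A t).card : ℝ) ≤ n := by exact_mod_cast hn t
    linarith
  refine (Finset.sum_le_sum h).trans (le_of_eq ?_)
  simp
  ring

theorem IsMatchTypedUCBRun.regret_le_of_isConcentrated [Fintype C]
    (hrun : IsMatchTypedUCBRun c (typedUtility c f) A ε X τ)
    (hf : ∀ x y, f x y ∈ Set.Icc (-1 : ℝ) 1) {n : ℕ} (hn : ∀ t, (A t).card ≤ n) {ω : Ω}
    (hL : 0 ≤ Real.log (Fintype.card (I ⊕ J) * T))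
    (hc : IsConcentrated c A (fun s => X s ω) (fun a s => ε a s ω)
      (Real.log (Fintype.card (I ⊕ J) * T))) :
    regret (typedUtility c f) A X τ ω ≤
      64 * (Fintype.card C * √(n * T * Real.log (Fintype.card (I ⊕ J) * T))) +
        4 * (Fintype.card C ^ 2 * n) := by
  choose v hv hout using fun t => hrun.output t ω
  have hX : ∀ t, IsMatchingOn (A t) (X t ω) := fun t => (hout t).1
  have hb := fun t x y => hc.upperConfidence hL hX hf (hv t x y)
  set L := Real.log (Fintype.card (I ⊕ J) * T)
  calc regret (typedUtility c f) A X τ ω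
      ≤ ∑ t, ∑ q : C × C,
          (observers c (A t) (X t ω) q.1 q.2).card * (v t q.1 q.2 - f q.1 q.2) := by
        refine Finset.sum_le_sum fun t _ => ?_
        rw [← (hX t).sum_typedUtility_sub]
        exact (hout t).subsetInstability_le (typedUtility_self _ _)
          (typedUtility_mono c fun a b => (hb t _ _).1)
    _ = ∑ q : C × C, ∑ t,
          (observers c (A t) (X t ω) q.1 q.2).card * (v t q.1 q.2 - f q.1 q.2) :=
        Finset.sum_comm
    _ ≤ ∑ q : C × C, (4 * n +
          64 * √L * √(∑ s, (observers c (A s) (X s ω) q.1 q.2).card : ℕ)) := by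
        refine Finset.sum_le_sum fun q _ => ?_
        refine sum_batch_le hL (fun t => (card_observers_le_card c _ _).trans (hn t))
          (fun t => ?_) fun t ht => (hb t q.1 q.2).2 ht
        have h1 := (hv t q.1 q.2).1.2
        have h2 := (hf q.1 q.2).1
        linarith
    _ ≤ (Fintype.card C) ^ 2 * (4 * n) + 64 * √L * (Fintype.card C * √(n * T)) := by
        rw [Finset.sum_add_distrib, ← Finset.mul_sum (a := 64 * √L)]
        refine add_le_add (le_of_eq ?_)
          (mul_le_mul_of_nonneg_left (sum_sqrt_typeCount_le hn) (by positivity))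
        simp [sq]
    _ = _ := by
        rw [Real.sqrt_mul (by positivity : (0 : ℝ) ≤ n * T)]
        ring

/-- With at most one agent all utilities and their bounds vanish. This case is separated because
`log (N T)` may then be zero. -/
theorem regret_nonpos_of_card_le_one (hrun : IsMatchTypedUCBRun c (typedUtility c f) A ε X τ)
    (hN : Fintype.card (I ⊕ J) ≤ 1) (ω : Ω) : regret (typedUtility c f) A X τ ω ≤ 0 := by
  refine Finset.sum_nonpos fun t _ => ?_
  obtain ⟨v, -, hout⟩ := hrun.output t ω
  have hsub := Fintype.card_le_one_iff_subsingleton.1 hN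
  have hz : ∀ (g : C → C → ℝ) (a b : I ⊕ J), typedUtility c g a b = 0 := fun g a b => by
    rw [Subsingleton.elim b a, typedUtility_self]
  refine (hout.subsetInstability_le (typedUtility_self _ _) fun a b => ?_).trans ?_
  · rw [hz, hz]
  · simp [hz]

variable [mΩ : MeasurableSpace Ω] {μ : Measure Ω} [IsProbabilityMeasure μ]

theorem IsMatchTypedUCBRun.measurable_regret (hrun : IsMatchTypedUCBRun c u A ε X τ)
    (hε : ∀ a t, Measurable (ε a t)) : Measurable (regret u A X τ) := by
  refine Finset.measurable_sum _ fun t _ => ?_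
  have hX : ∀ Y, MeasurableSet {ω | X t ω = Y} := fun Y =>
    past_le hε t _ (hrun.matching_nonanticipating t Y)
  have h : (fun ω => subsetInstability (A t) u (X t ω) (τ t ω)) =
      (A t).powerset.sup' (Finset.powerset_nonempty _) fun S ω =>
        maxMatchingUtility u S - ∑ a ∈ S, (u a (partner (X t ω) a) + τ t ω a) := by
    ext ω
    exact (Finset.sup'_apply (Finset.powerset_nonempty _) (fun S ω =>
      maxMatchingUtility u S - ∑ a ∈ S, (u a (partner (X t ω) a) + τ t ω a)) ω).symm
  rw [h]
  refine Finset.measurable_sup' _ fun S hS => Measurable.const_sub ?_ _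
  refine Finset.measurable_sum _ fun a ha => Measurable.add ?_ ?_
  · exact measurable_comp_of_finite hX fun Y => u a (partner Y a)
  · exact (hrun.transfers_nonanticipating t a (Finset.mem_powerset.1 hS ha)).mono
      (past_le hε t) le_rfl

theorem IsMatchTypedUCBRun.measurableSet_deviationEvent
    (hrun : IsMatchTypedUCBRun c u A ε X τ) (hε : ∀ a t, Measurable (ε a t)) (L : ℝ) :
    MeasurableSet (deviationEvent c A ε X L) := by
  rw [deviationEvent_eq]
  refine MeasurableSet.iUnion fun q => ?_
  have hO := hrun.measurableSet_observers (c q.2.1) (c q.2.2)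
  have h1 := measurable_observationCount hO (k := q.1) fun s _ => past_le hε s
  have h2 := measurable_observationNoise hO (k := q.1) (fun s _ => past_le hε s)
    fun s _ a => hε a s
  have h3 : Measurable fun ω => (observationCount (fun s ω =>
      observers c (A s) (X s ω) (c q.2.1) (c q.2.2)) q.1 ω : ℝ) :=
    (measurable_from_top (f := fun i : ℕ => (i : ℝ))).comp h1
  refine MeasurableSet.inter (measurableSet_lt measurable_const h1) ?_
  exact measurableSet_lt ((h3.mul_const L).sqrt.const_mul 8) h2.abs

/-- Large deviations of the noise contribute at most `2` rounds in expectation. -/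
theorem IsMatchTypedUCBRun.measureReal_deviationEvent_le
    (hrun : IsMatchTypedUCBRun c u A ε X τ) (hε : ∀ a t, Measurable (ε a t))
    (hind : iIndepFun (fun q : (I ⊕ J) × Fin T => ε q.1 q.2) μ)
    (hsub : ∀ a t, HasSubgaussianMGF (ε a t) 1 μ)
    (hNT : 1 ≤ Fintype.card (I ⊕ J) * T) :
    T * μ.real (deviationEvent c A ε X (Real.log (Fintype.card (I ⊕ J) * T))) ≤ 2 := by
  set N := Fintype.card (I ⊕ J)
  have hNT' : (1 : ℝ) ≤ N * T := by exact_mod_cast hNT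
  have hL : 0 ≤ Real.log (N * T) := Real.log_nonneg hNT'
  have hexp : Real.exp (-(32 * Real.log (N * T))) = ((N * T : ℝ) ^ 32)⁻¹ := by
    rw [Real.exp_neg, show 32 * Real.log (N * T) = ((32 : ℕ) : ℝ) * Real.log (N * T) by norm_num,
      Real.exp_nat_mul, Real.exp_log (by linarith)]
  have hT1 : (1 : ℝ) ≤ T := by
    exact_mod_cast Nat.one_le_iff_ne_zero.2 fun h => by simp [h] at hNT
  have hN1 : (1 : ℝ) ≤ N := by
    exact_mod_cast Nat.one_le_iff_ne_zero.2 fun h => by rw [h] at hNT; simp at hNT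
  set B : ℝ := N * T * (2 * Real.exp (-(32 * Real.log (N * T)))) with hB
  have hB0 : 0 ≤ B := by positivity
  -- A union over `T` rounds and `N²` ordered pairs of agents; `B` already includes the union over
  -- counts and signs.
  have h1 : μ (deviationEvent c A ε X (Real.log (N * T))) ≤ ENNReal.ofReal (T * (N * N) * B) := by
    rw [deviationEvent_eq]
    refine (measure_iUnion_fintype_le _ _).trans ?_
    refine (Finset.sum_le_sum fun q _ => measure_observationNoise_abs_gt_le hε hind hsub
      (hrun.measurableSet_observers (c q.2.1) (c q.2.2)) q.1.2.le hL).trans ?_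
    rw [Finset.sum_const, nsmul_eq_mul, Finset.card_univ, Fintype.card_prod, Fintype.card_prod,
      Fintype.card_fin, ENNReal.ofReal_mul (p := (T * (N * N) : ℝ)) (by positivity),
      ← ENNReal.ofReal_natCast]
    push_cast
    rfl
  have h2 : μ.real (deviationEvent c A ε X (Real.log (N * T))) ≤ T * (N * N) * B :=
    ENNReal.toReal_le_of_le_ofReal (by positivity) h1
  -- Together with the extra factor `T`, the union bounds cost `2 (N T)³`, against the tail `(N
  -- T)⁻³²`.
  have h3 : T * (T * (N * N) * B) ≤ 2 := by
    rw [hB, hexp]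
    have h4 : (N * T : ℝ) ^ 3 ≤ (N * T : ℝ) ^ 32 := pow_le_pow_right₀ hNT' (by norm_num)
    have h5 : (0 : ℝ) < (N * T : ℝ) ^ 32 := by positivity
    have h6 : (T : ℝ) * (T * (N * N) * (N * T * (2 * ((N * T : ℝ) ^ 32)⁻¹))) =
        2 * ((N * T : ℝ) ^ 3 / (N * T : ℝ) ^ 32) := by
      rw [div_eq_mul_inv]
      ring
    rw [h6]
    linarith [(div_le_one h5).2 h4]
  exact (mul_le_mul_of_nonneg_left h2 (by positivity)).trans h3

theorem IsMatchTypedUCBRun.integrable_regret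
    (hrun : IsMatchTypedUCBRun c (typedUtility c f) A ε X τ)
    (hf : ∀ x y, f x y ∈ Set.Icc (-1 : ℝ) 1) {n : ℕ} (hn : ∀ t, (A t).card ≤ n)
    (hε : ∀ a t, Measurable (ε a t)) : Integrable (regret (typedUtility c f) A X τ) μ := by
  refine Integrable.of_bound (hrun.measurable_regret hε).aestronglyMeasurable (3 * n * T)
    (ae_of_all _ fun ω => ?_)
  rw [Real.norm_of_nonneg (regret_nonneg ω)]
  exact hrun.regret_le hf hn ω

theorem IsMatchTypedUCBRun.integral_regret_le [Fintype C]
    (hrun : IsMatchTypedUCBRun c (typedUtility c f) A ε X τ)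
    (hf : ∀ x y, f x y ∈ Set.Icc (-1 : ℝ) 1) {n : ℕ} (hn : ∀ t, (A t).card ≤ n)
    (hε : ∀ a t, Measurable (ε a t))
    (hind : iIndepFun (fun q : (I ⊕ J) × Fin T => ε q.1 q.2) μ)
    (hsub : ∀ a t, HasSubgaussianMGF (ε a t) 1 μ) (hNT : 1 ≤ Fintype.card (I ⊕ J) * T) :
    ∫ ω, regret (typedUtility c f) A X τ ω ∂μ ≤
      64 * (Fintype.card C * √(n * T * Real.log (Fintype.card (I ⊕ J) * T))) +
        10 * (Fintype.card C ^ 2 * n) := by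
  have hNT' : (1 : ℝ) ≤ Fintype.card (I ⊕ J) * T := by exact_mod_cast hNT
  have hL := Real.log_nonneg hNT'
  have hdev := hrun.measureReal_deviationEvent_le hε hind hsub hNT
  have hmeas := hrun.measurableSet_deviationEvent hε (Real.log (Fintype.card (I ⊕ J) * T))
  have hC1 : (1 : ℝ) ≤ Fintype.card C := by
    have hpos : 0 < Fintype.card (I ⊕ J) := Nat.pos_of_mul_pos_right hNT
    obtain ⟨a⟩ := Fintype.card_pos_iff.1 hpos
    exact_mod_cast Fintype.card_pos_iff.2 ⟨c a⟩
  set D := deviationEvent c A ε X (Real.log (Fintype.card (I ⊕ J) * T)) with hD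
  set B : ℝ := 64 * (Fintype.card C * √(n * T * Real.log (Fintype.card (I ⊕ J) * T))) +
        4 * (Fintype.card C ^ 2 * n) with hB
  have hB0 : 0 ≤ B := by positivity
  have hpt : ∀ ω, regret (typedUtility c f) A X τ ω ≤ B + D.indicator (fun _ => (3 * n * T : ℝ)) ω := by
    intro ω
    by_cases hω : ω ∈ D
    · rw [Set.indicator_of_mem hω]
      linarith [hrun.regret_le hf hn ω]
    · rw [Set.indicator_of_notMem hω, add_zero]
      exact hrun.regret_le_of_isConcentrated hf hn hL (not_not.1 hω)
  have hint : Integrable (D.indicator fun _ => (3 * n * T : ℝ)) μ :=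
    (integrable_const _).indicator hmeas
  calc ∫ ω, regret (typedUtility c f) A X τ ω ∂μ
      ≤ ∫ ω, (B + D.indicator (fun _ => (3 * n * T : ℝ)) ω) ∂μ :=
        integral_mono (hrun.integrable_regret hf hn hε) ((integrable_const _).add hint) hpt
    _ = B + 3 * n * (T * μ.real D) := by
        rw [integral_add (integrable_const _) hint, integral_indicator_const _ hmeas]
        simp
        ring
    -- The exceptional event costs `6n`, absorbed into `6 |C|² n` because the existence of an agent
    -- forces `|C| ≥ 1`.
    _ ≤ B + 3 * n * 2 := by gcongr
    _ ≤ _ := by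
        have h1 : (1 : ℝ) ≤ (Fintype.card C : ℝ) ^ 2 := one_le_pow₀ hC1
        have h2 : (n : ℝ) ≤ Fintype.card C ^ 2 * n := le_mul_of_one_le_left (by positivity) h1
        rw [hB]
        linarith

end Regret

end TypedMatching

end

/-! ### The regret bounds -/

theorem theorem5p2 :
    ∃ K : ℝ, 0 < K ∧
      ∀ (I : Type u₁) (J : Type u₂) (C : Type u₃) [Fintype I] [Fintype J] [Fintype C]
        (c : I ⊕ J → C) (u : TypedMatching.Utility I J), u ∈ TypedMatching.typedPreferences c →
      ∀ (T : ℕ) (A : Fin T → Finset (I ⊕ J)) (n : ℕ), n = Finset.univ.sup (fun t => (A t).card) →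
      ∀ (Ω : Type u₄) [MeasurableSpace Ω] (μ : MeasureTheory.Measure Ω)
        [MeasureTheory.IsProbabilityMeasure μ] (ε : I ⊕ J → Fin T → Ω → ℝ),
        (∀ a t, Measurable (ε a t)) →
        ProbabilityTheory.iIndepFun (fun q : (I ⊕ J) × Fin T => ε q.1 q.2) μ →
        (∀ a t, ProbabilityTheory.HasSubgaussianMGF (ε a t) 1 μ) →
      ∀ (X : Fin T → Ω → Finset (I × J)) (τ : Fin T → Ω → I ⊕ J → ℝ),
        TypedMatching.IsMatchTypedUCBRun c u A ε X τ →
        MeasureTheory.Integrable (TypedMatching.regret u A X τ) μ ∧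
        ∫ ω, TypedMatching.regret u A X τ ω ∂μ ≤
          K * (Fintype.card C * √(n * T * Real.log (Fintype.card (I ⊕ J) * T))
            + Fintype.card C ^ 2 * n) ∧
        (Fintype.card C ^ 2 * n ≤ T →
          ∫ ω, TypedMatching.regret u A X τ ω ∂μ ≤
            K * (Fintype.card C * √(n * T * Real.log (Fintype.card (I ⊕ J) * T)))) := by
  -- The main bound is `64 s + 10 b`; in the long-horizon regime `b ≤ 2 s` makes it at most `84 s`.
  refine ⟨100, by norm_num, ?_⟩
  intro I J C _ _ _ c u hu T A n hn Ω _ μ _ ε hε hind hsub X τ hrun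
  obtain ⟨f, hf, rfl⟩ := hu
  have hn' : ∀ t, (A t).card ≤ n := fun t => by
    rw [hn]; exact Finset.le_sup (f := fun t => (A t).card) (Finset.mem_univ t)
  refine ⟨hrun.integrable_regret hf hn' hε, ?_⟩
  set L := Real.log (Fintype.card (I ⊕ J) * T) with hL
  set s := (Fintype.card C : ℝ) * √(n * T * L) with hs
  have hs0 : 0 ≤ s := by positivity
  set b := (Fintype.card C : ℝ) ^ 2 * n with hb
  have hb0 : 0 ≤ b := by positivity
  have hzero : (∀ ω, TypedMatching.regret (TypedMatching.typedUtility c f) A X τ ω ≤ 0) →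
      ∫ ω, TypedMatching.regret (TypedMatching.typedUtility c f) A X τ ω ∂μ ≤ 0 :=
    fun h => integral_nonpos h
  rcases Nat.lt_or_ge 1 (Fintype.card (I ⊕ J)) with hN | hN
  swap
  · have h := hzero (TypedMatching.regret_nonpos_of_card_le_one hrun hN)
    exact ⟨by linarith, fun _ => by linarith⟩
  rcases Nat.eq_zero_or_pos T with hT | hT
  · have h := hzero fun ω => by subst hT; simp [TypedMatching.regret]
    exact ⟨by linarith, fun _ => by linarith⟩
  have hmain := hrun.integral_regret_le hf hn' hε hind hsub (Nat.mul_pos (by omega) hT)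
  refine ⟨by linarith, fun hle => ?_⟩
  have hbT : b ≤ T := by rw [hb]; exact_mod_cast hle
  have hNT : (2 : ℝ) ≤ Fintype.card (I ⊕ J) * T := by
    exact_mod_cast Nat.mul_le_mul hN hT
  have hL2 : 1 / 2 ≤ L := by
    have h1 : Real.log 2 ≤ L := Real.log_le_log (by norm_num) hNT
    linarith [Real.log_two_gt_d9]
  -- Since `s² = b T L`, the bounds `b ≤ T` and `L ≥ 1/2` give `b² ≤ b T ≤ 2 s²`.
  have hbs : b ≤ 2 * s := by
    refine (abs_le_of_sq_le_sq' ?_ (by positivity)).2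
    have h1 : s ^ 2 = b * (T * L) := by
      rw [hs, mul_pow, Real.sq_sqrt (by positivity), hb]
      ring
    rw [mul_pow 2 s, h1]
    have h2 : b ≤ 4 * (T * L) := by nlinarith
    nlinarith [mul_le_mul_of_nonneg_left h2 hb0]
  linarith
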